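/- Let $I=(0,1]$ and $\mathbb K\in\{\mathbb R,\mathbb C\}$. Let $\mathcal E_M(\mathbb K)$ be the ring of nets $(x_\varepsilon)_{\varepsilon}\in\mathbb K^I$ with $|x_\varepsilon|=O(\varepsilon^m)$ as $\varepsilon\to0$ for some $m\in\mathbb Z$ (moderate nets), $\mathcal N(\mathbb K)$ its ideal of nets with $|x_\varepsilon|=O(\varepsilon^m)$ as $\varepsilon\to0$ for every $m\in\mathbb Z$ (negligible nets), and $\widetilde{\mathbb K}=\mathcal E_M(\mathbb K)/\mathcal N(\mathbb K)$; regard $\widetilde{\mathbb R}$ as a subring of $\widetilde{\mathbb C}$ in the obvious way. A representative of a matrix $A\in M_n(\widetilde{\mathbb R})$ is a net $(A_\varepsilon)_\varepsilon$ of real $n\times n$ matrices such that for all $i,j$ the net of $(i,j)$ entries is moderate with class $A_{ij}$. Let $A\in M_n(\widetilde{\mathbb R})$ be symmetric, $A=A^t$. Given any representative $(A_\varepsilon)_\varepsilon$ of $A$ (not necessarily symmetric), for each $\varepsilon\in I$ let $\theta_{1,\varepsilon},\dots,\theta_{n,\varepsilon}\in\mathbb C$ be the eigenvalues of $A_\varepsilon$,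 counted with algebraic multiplicity and ordered so that $\operatorname{Re}\theta_{1,\varepsilon}\ge\dots\ge\operatorname{Re}\theta_{n,\varepsilon}$ (ties being broken arbitrarily). The generalized eigenvalues of $A$ are the classes $\lambda_k$ of $(\theta_{k,\varepsilon})_\varepsilon$ in $\widetilde{\mathbb C}$, $1\le k\le n$. Then: 1. The generalized eigenvalues are well-defined elements of $\widetilde{\mathbb R}$: each net $(\theta_{k,\varepsilon})_\varepsilon$ is moderate, and its class $\lambda_k$ lies in $\widetilde{\mathbb R}$ and depends neither on the representative of $A$ nor on the way ties are broken. 2. There is an orthogonal $U\in M_n(\widetilde{\mathbb R})$, that is, $UU^t=\mathbb I$ and $\det U=1$ in $\widetilde{\mathbb R}$, such that $UAU^t=\operatorname{diag}(\lambda_1,\dots,\lambda_n)$. 3. $A$ is non-degenerate (that is, for $\xi\in\widetilde{\mathbb R}^n$, if $\xi^tA\eta=0$ for all $\eta\in\widetilde{\mathbb R}^n$, then $\xi=0$) if and only if all of $\lambda_1,\dots,\lambda_n$ are invertible in $\widetilde{\mathbb R}$. -/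

import Mathlib

open Filter Topology Asymptotics

noncomputable section

namespace Colombeau

/-- The index set `(0, 1]` of the nets. -/
abbrev Idx : Type := Set.Ioc (0 : ℝ) 1

/-- The filter `ε → 0` on the index set `(0, 1]`. -/
def toZero : Filter Idx := comap Subtype.val (𝓝 (0 : ℝ))

/-- A net is moderate if it is `O(ε ^ m)` as `ε → 0` for some integer `m`. -/
def IsModerate {𝕜 : Type} [RCLike 𝕜] (x : Idx → 𝕜) : Prop :=
  ∃ m : ℤ, x =O[toZero] fun ε => (ε : ℝ) ^ m

/-- A net is negligible if it is `O(ε ^ m)` as `ε → 0` for every integer `m`. -/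
def IsNegligible {𝕜 : Type} [RCLike 𝕜] (x : Idx → 𝕜) : Prop :=
  ∀ m : ℤ, x =O[toZero] fun ε => (ε : ℝ) ^ m

theorem isBigO_zpow_of_le {k m : ℤ} (h : k ≤ m) :
    (fun ε : Idx => (ε : ℝ) ^ m) =O[toZero] fun ε : Idx => (ε : ℝ) ^ k := by
  refine IsBigO.of_bound 1 (Eventually.of_forall fun ε => ?_)
  have h0 : (0 : ℝ) < ε := ε.2.1
  rw [Real.norm_of_nonneg (zpow_nonneg h0.le _), Real.norm_of_nonneg (zpow_nonneg h0.le _), one_mul]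
  exact zpow_le_zpow_right_of_le_one₀ h0 ε.2.2 h

section Ring

variable (𝕜 : Type) [RCLike 𝕜]

theorem isBigO_mul_zpow {x y : Idx → 𝕜} {k m : ℤ}
    (hx : x =O[toZero] fun ε => (ε : ℝ) ^ k) (hy : y =O[toZero] fun ε => (ε : ℝ) ^ m) :
    (x * y) =O[toZero] fun ε => (ε : ℝ) ^ (k + m) := by
  have h : (fun ε : Idx => (ε : ℝ) ^ (k + m)) = fun ε : Idx => (ε : ℝ) ^ k * (ε : ℝ) ^ m := by
    funext ε
    exact zpow_add₀ (ne_of_gt ε.2.1) k m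
  rw [h]
  exact hx.mul hy

theorem isModerate_const (c : 𝕜) : IsModerate (fun _ : Idx => c) := by
  refine ⟨0, IsBigO.of_bound ‖c‖ (Eventually.of_forall fun ε => ?_)⟩
  simp

/-- The ring of moderate nets in `𝕜`. -/
def moderate : Subring (Idx → 𝕜) where
  carrier := {x | IsModerate x}
  mul_mem' := by
    rintro x y ⟨k, hx⟩ ⟨m, hy⟩
    exact ⟨k + m, isBigO_mul_zpow 𝕜 hx hy⟩
  one_mem' := isModerate_const 𝕜 1
  add_mem' := by
    rintro x y ⟨k, hx⟩ ⟨m, hy⟩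
    exact ⟨min k m, (hx.trans (isBigO_zpow_of_le (min_le_left k m))).add
      (hy.trans (isBigO_zpow_of_le (min_le_right k m)))⟩
  zero_mem' := isModerate_const 𝕜 0
  neg_mem' := by
    rintro x ⟨k, hx⟩
    exact ⟨k, hx.neg_left⟩

/-- The ideal of negligible nets in the ring of moderate nets. -/
def negligible : Ideal (moderate 𝕜) where
  carrier := {x | IsNegligible (x : Idx → 𝕜)}
  add_mem' := fun hx hy m => (hx m).add (hy m)
  zero_mem' := fun m => isBigO_zero _ _
  smul_mem' := by
    rintro ⟨c, k, hc⟩ x hx m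
    have h := isBigO_mul_zpow 𝕜 hc (hx (m - k))
    rwa [add_sub_cancel] at h

/-- The ring of generalized numbers over `𝕜`: moderate nets modulo negligible nets. -/
abbrev GenNum : Type := moderate 𝕜 ⧸ negligible 𝕜

end Ring

/-- The net `x` is moderate and its class is the generalized number `a`. -/
def Represents {𝕜 : Type} [RCLike 𝕜] (x : Idx → 𝕜) (a : GenNum 𝕜) : Prop :=
  ∃ h : x ∈ moderate 𝕜, Ideal.Quotient.mk (negligible 𝕜) ⟨x, h⟩ = a

theorem isBigO_ofReal_iff (x : Idx → ℝ) (m : ℤ) :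
    ((fun ε => (x ε : ℂ)) =O[toZero] fun ε => (ε : ℝ) ^ m) ↔
      x =O[toZero] fun ε => (ε : ℝ) ^ m := by
  rw [← isBigO_norm_left, ← isBigO_norm_left (f' := x)]
  simp

/-- A moderate real net, viewed as a moderate complex net. -/
def moderateOfReal : moderate ℝ →+* moderate ℂ :=
  (Complex.ofRealHom.compLeft Idx).restrict (moderate ℝ) (moderate ℂ)
    fun x ⟨m, hm⟩ => ⟨m, (isBigO_ofReal_iff x m).2 hm⟩

theorem negligible_le_comap :
    negligible ℝ ≤ (negligible ℂ).comap moderateOfReal :=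
  fun x hx m => (isBigO_ofReal_iff (x : Idx → ℝ) m).2 (hx m)

/-- The inclusion of the real into the complex generalized numbers, sending the class of a real net
to the class of the same net. -/
def ofReal : GenNum ℝ →+* GenNum ℂ :=
  Ideal.quotientMap (negligible ℂ) moderateOfReal negligible_le_comap

theorem ofReal_injective : Function.Injective ofReal := by
  refine Ideal.quotientMap_injective' (fun x hx m => ?_)
  exact (isBigO_ofReal_iff (x : Idx → ℝ) m).1 (hx m)

section MatrixNotions

variable {n : ℕ}

/-- The net `M` of real matrices is a representative of the generalized matrix `A`. -/
def IsRepresentative (M : Idx → Matrix (Fin n) (Fin n) ℝ)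
    (A : Matrix (Fin n) (Fin n) (GenNum ℝ)) : Prop :=
  ∀ i j, Represents (fun ε => M ε i j) (A i j)

/-- `θ` lists the complex eigenvalues of the real matrix `M`, with algebraic multiplicity, by
non-increasing real parts. -/
def IsOrderedEigenvalues (M : Matrix (Fin n) (Fin n) ℝ) (θ : Fin n → ℂ) : Prop :=
  Finset.univ.val.map θ = (M.map Complex.ofReal).charpoly.roots ∧
    Antitone fun k => (θ k).re

/-- `Θ` is a system of generalized eigenvalues of `A`: for some representative of `A` and some
choice, for each `ε`, of an ordered list of its eigenvalues, `Θ k` is the class of the net of the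
`k`-th eigenvalues. -/
def IsGeneralizedEigenvalues (A : Matrix (Fin n) (Fin n) (GenNum ℝ))
    (Θ : Fin n → GenNum ℂ) : Prop :=
  ∃ (M : Idx → Matrix (Fin n) (Fin n) ℝ) (θ : Idx → Fin n → ℂ),
    IsRepresentative M A ∧ (∀ ε, IsOrderedEigenvalues (M ε) (θ ε)) ∧
      ∀ k, Represents (fun ε => θ ε k) (Θ k)

/-- Orthogonal generalized matrices; the determinant is required to be `1`. -/
def IsOrthogonal (U : Matrix (Fin n) (Fin n) (GenNum ℝ)) : Prop :=
  U * U.transpose = 1 ∧ U.det = 1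

/-- Non-degenerate: `ξᵗ A η = 0` for all `η` implies `ξ = 0`. -/
def IsNonDegenerate (A : Matrix (Fin n) (Fin n) (GenNum ℝ)) : Prop :=
  ∀ ξ : Fin n → GenNum ℝ, (∀ η : Fin n → GenNum ℝ, ξ ⬝ᵥ A.mulVec η = 0) → ξ = 0

end MatrixNotions

end Colombeau

end

namespace Colombeau

/-! Choose a symmetric representative and apply the spectral theorem at each ε. Rotations have
entries bounded by 1 and eigenvalues are bounded by the sum of the entries, so all nets involved are
moderate and the identities pass to classes.

Independence of the representative comes from the characteristic polynomial, which depends only on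
`A`. Two factorizations of it into linear factors have the same roots up to an ε-dependent
permutation and negligible errors (`exists_perm_of_prod_X_sub_C_eq`), although the ring has zero
divisors. As one list is real and both are ordered by real part, the permutation can be dropped
(`norm_sub_ofReal_le_of_perm`).

After diagonalization, non-degeneracy makes every eigenvalue a non-zero-divisor, and such
generalized numbers are units (`isUnit_of_forall_mul_eq_zero`). -/

/-! ### Linear algebra at a fixed ε. -/

theorem exists_orthogonal_diagonalization {n : ℕ} {S : Matrix (Fin n) (Fin n) ℝ}
    (hS : S.IsSymm) :
    ∃ (U : Matrix (Fin n) (Fin n) ℝ) (s : Fin n → ℝ), U * U.transpose = 1 ∧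
      U * S * U.transpose = Matrix.diagonal s ∧ Antitone s := by
  have hH : S.IsHermitian := by
    rwa [Matrix.IsHermitian, Matrix.conjTranspose_eq_transpose_of_trivial]
  set P : Matrix (Fin n) (Fin n) ℝ := hH.eigenvectorUnitary.1 with hP
  have hstar : star P = P.transpose := by
    rw [Matrix.star_eq_conjTranspose, Matrix.conjTranspose_eq_transpose_of_trivial]
  have hPP : P.transpose * P = 1 := by
    rw [← hstar]; exact Unitary.coe_star_mul_self hH.eigenvectorUnitary
  have hD : P.transpose * S * P = Matrix.diagonal hH.eigenvalues := by
    have h := hH.conjStarAlgAut_star_eigenvectorUnitary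
    rw [Unitary.conjStarAlgAut_star_apply] at h
    rw [← hstar]
    simpa [Function.comp_def] using h
  let τ : Equiv.Perm (Fin n) := Tuple.sort fun i => -hH.eigenvalues i
  refine ⟨P.transpose.submatrix τ id, hH.eigenvalues ∘ τ, ?_, ?_, ?_⟩
  · rw [Matrix.transpose_submatrix, Matrix.transpose_transpose,
      ← Matrix.submatrix_mul _ _ _ _ _ Function.bijective_id, hPP,
      Matrix.submatrix_one_equiv]
  · have h1 : P.transpose.submatrix τ id * S = (P.transpose * S).submatrix τ id := by
      rw [Matrix.submatrix_mul _ _ _ _ _ Function.bijective_id, Matrix.submatrix_id_id]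
    rw [h1, Matrix.transpose_submatrix, Matrix.transpose_transpose,
      ← Matrix.submatrix_mul _ _ _ _ _ Function.bijective_id, hD,
      Matrix.submatrix_diagonal_equiv]
  · intro i j hij
    have := Tuple.monotone_sort (fun i => -hH.eigenvalues i) hij
    simpa [τ] using this

/-- A real symmetric matrix is diagonalized by a rotation, with the diagonal entries in
non-increasing order. -/
theorem exists_rotation_diagonalization {n : ℕ} {S : Matrix (Fin n) (Fin n) ℝ}
    (hS : S.IsSymm) :
    ∃ (U : Matrix (Fin n) (Fin n) ℝ) (s : Fin n → ℝ), U * U.transpose = 1 ∧ U.det = 1 ∧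
      U * S * U.transpose = Matrix.diagonal s ∧ Antitone s := by
  obtain ⟨V, s, hV, hs, hanti⟩ := exists_orthogonal_diagonalization hS
  rcases n with _ | n
  · exact ⟨V, s, hV, Matrix.det_isEmpty, hs, hanti⟩
  have hdet : V.det * V.det = 1 := by
    have := congrArg Matrix.det hV
    rwa [Matrix.det_mul, Matrix.det_transpose, Matrix.det_one] at this
  -- Scaling the first row by `V.det = ±1` makes the determinant 1 and leaves the diagonal form
  -- unchanged.
  let d : Fin (n + 1) → ℝ := Fin.cons V.det fun _ => 1
  have hd : ∀ i, d i * d i = 1 := fun i => by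
    refine Fin.cases ?_ (fun j => ?_) i
    · simpa [d] using hdet
    · simp [d]
  refine ⟨Matrix.diagonal d * V, s, ?_, ?_, ?_, hanti⟩
  · rw [Matrix.transpose_mul, Matrix.diagonal_transpose, mul_assoc, ← mul_assoc V, hV, one_mul,
      Matrix.diagonal_mul_diagonal, ← Matrix.diagonal_one]
    exact congrArg Matrix.diagonal (funext hd)
  · rw [Matrix.det_mul, Matrix.det_diagonal, Fin.prod_univ_succ]
    simpa [d] using hdet
  · rw [Matrix.transpose_mul, Matrix.diagonal_transpose,
      show Matrix.diagonal d * V * S * (V.transpose * Matrix.diagonal d) =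
        Matrix.diagonal d * (V * S * V.transpose) * Matrix.diagonal d by simp only [mul_assoc],
      hs, Matrix.diagonal_mul_diagonal, Matrix.diagonal_mul_diagonal]
    refine congrArg Matrix.diagonal (funext fun i => ?_)
    rw [mul_right_comm, hd, one_mul]

theorem charpoly_eq_prod_of_diagonalization {n : ℕ} {R : Type*} [CommRing R]
    {S U : Matrix (Fin n) (Fin n) R} {s : Fin n → R} (hU : U * U.transpose = 1)
    (h : U * S * U.transpose = Matrix.diagonal s) :
    S.charpoly = ∏ i, (Polynomial.X - Polynomial.C (s i)) := by
  rw [← Matrix.charpoly_diagonal, ← h, Matrix.charpoly_mul_comm, ← mul_assoc,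
    mul_eq_one_comm.1 hU, one_mul]

/-- Two non-increasing lists that agree up to `δ` after a permutation agree up to `δ`. -/
theorem antitone_le_add_of_perm {n : ℕ} {f g : Fin n → ℝ} (hf : Antitone f) (hg : Antitone g)
    (σ : Equiv.Perm (Fin n)) {δ : ℝ} (h : ∀ i, f (σ i) ≤ g i + δ) (k : Fin n) :
    f k ≤ g k + δ := by
  -- Pigeonhole: `σ` cannot inject the indices `≥ k` into the fewer indices `> k`.
  obtain ⟨i, hki, hik⟩ : ∃ i, k ≤ i ∧ σ i ≤ k := by
    by_contra! hcon
    have h1 : (Finset.Ici k).map σ.toEmbedding ⊆ Finset.Ioi k := by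
      intro j hj
      obtain ⟨i, hi, rfl⟩ := Finset.mem_map.1 hj
      exact Finset.mem_Ioi.2 (hcon i (Finset.mem_Ici.1 hi))
    have h2 := Finset.card_le_card h1
    rw [Finset.card_map, Fin.card_Ici, Fin.card_Ioi] at h2
    omega
  calc f k ≤ f (σ i) := hf hik
    _ ≤ g i + δ := h i
    _ ≤ g k + δ := by linarith [hg hki]

/-- Real parts are compared by sorting; imaginary parts are small whatever the matching, because `s`
is real. Each contributes one `δ`. -/
theorem norm_sub_ofReal_le_of_perm {n : ℕ} {a : Fin n → ℂ} {s : Fin n → ℝ}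
    (ha : Antitone fun k => (a k).re) (hs : Antitone s) (σ : Equiv.Perm (Fin n)) {δ : ℝ}
    (h : ∀ i, ‖a (σ i) - s i‖ ≤ δ) (k : Fin n) : ‖a k - s k‖ ≤ 2 * δ := by
  have hre : ∀ i, |(a (σ i)).re - s i| ≤ δ := fun i =>
    (by simpa using Complex.abs_re_le_norm (a (σ i) - s i) : _ ≤ _).trans (h i)
  have him : ∀ i, |(a (σ i)).im| ≤ δ := fun i =>
    (by simpa using Complex.abs_im_le_norm (a (σ i) - s i) : _ ≤ _).trans (h i)
  have h1 := antitone_le_add_of_perm ha hs σ (δ := δ)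
    (fun i => by linarith [(abs_le.1 (hre i)).2]) k
  have h2 := antitone_le_add_of_perm hs ha σ.symm (δ := δ)
    (fun i => by have := (abs_le.1 (hre (σ.symm i))).1; simp at this; linarith) k
  have h3 := him (σ.symm k)
  rw [σ.apply_symm_apply] at h3
  refine (Complex.norm_le_abs_re_add_abs_im _).trans ?_
  have h4 : |(a k - s k).re| ≤ δ := by
    rw [Complex.sub_re, Complex.ofReal_re, abs_le]
    constructor <;> linarith
  have h5 : |(a k - s k).im| ≤ δ := by simpa using h3
  linarith

/-- The eigenvalues of a complex matrix are bounded by the sum of the norms of the entries. -/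
theorem norm_le_sum_of_isRoot_charpoly {n : ℕ} {M : Matrix (Fin n) (Fin n) ℂ} {z : ℂ}
    (hz : M.charpoly.IsRoot z) : ‖z‖ ≤ ∑ i, ∑ j, ‖M i j‖ := by
  obtain ⟨v, hv0, hv⟩ := Matrix.exists_mulVec_eq_zero_iff.2
    (show (Matrix.scalar (Fin n) z - M).det = 0 by
      rw [← Matrix.eval_charpoly]; exact hz)
  have hv' : ∀ i, z * v i = ∑ j, M i j * v j := fun i => by
    have := congrFun hv i
    simp only [Matrix.sub_mulVec, Matrix.scalar_apply, Pi.sub_apply, Matrix.mulVec_diagonal,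
      Pi.zero_apply, sub_eq_zero] at this
    exact this
  obtain ⟨i, hi⟩ : ∃ i, v i ≠ 0 := Function.ne_iff.1 hv0
  -- Row `k` of the eigenvector equation, at a largest coordinate of `v`, gives the bound.
  obtain ⟨k, -, hk⟩ := Finset.exists_max_image Finset.univ (fun i => ‖v i‖) ⟨i, Finset.mem_univ _⟩
  have hk0 : 0 < ‖v k‖ := (norm_pos_iff.2 hi).trans_le (hk i (Finset.mem_univ _))
  refine le_trans (le_of_mul_le_mul_right ?_ hk0)
    (Finset.single_le_sum (f := fun i => ∑ j, ‖M i j‖)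
      (fun i _ => Finset.sum_nonneg fun j _ => norm_nonneg _) (Finset.mem_univ k))
  rw [← norm_mul, hv', Finset.sum_mul]
  refine (norm_sum_le _ _).trans (Finset.sum_le_sum fun j _ => ?_)
  rw [norm_mul]
  exact mul_le_mul_of_nonneg_left (hk j (Finset.mem_univ _)) (norm_nonneg _)


/-! ### Moderate and negligible nets, and matching of roots. -/

section Nets

variable {𝕜 : Type} [RCLike 𝕜]

theorem IsModerate.of_norm_le {𝕜' : Type} [RCLike 𝕜'] {x : Idx → 𝕜} {y : Idx → 𝕜'}
    (hy : IsModerate y) (h : ∀ ε, ‖x ε‖ ≤ ‖y ε‖) : IsModerate x :=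
  hy.imp fun _ hm => (IsBigO.of_bound' (Eventually.of_forall h)).trans hm

theorem IsNegligible.of_norm_le {𝕜' : Type} [RCLike 𝕜'] {x : Idx → 𝕜} {y : Idx → 𝕜'}
    (hy : IsNegligible y) (h : ∀ ε, ‖x ε‖ ≤ ‖y ε‖) : IsNegligible x :=
  fun m => (IsBigO.of_bound' (Eventually.of_forall h)).trans (hy m)

theorem IsModerate.norm {x : Idx → 𝕜} (hx : IsModerate x) : IsModerate fun ε => ‖x ε‖ :=
  hx.of_norm_le fun _ => (norm_norm _).le

theorem IsNegligible.norm {x : Idx → 𝕜} (hx : IsNegligible x) : IsNegligible fun ε => ‖x ε‖ :=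
  hx.of_norm_le fun _ => (norm_norm _).le

theorem IsModerate.sum {ι : Type*} [Fintype ι] {x : ι → Idx → 𝕜}
    (hx : ∀ i, IsModerate (x i)) : IsModerate fun ε => ∑ i, x i ε := by
  have h : ∑ i, x i ∈ moderate 𝕜 := Subring.sum_mem _ fun i _ => hx i
  convert! h using 1
  ext ε
  simp

theorem IsNegligible.sum {ι : Type*} [Fintype ι] {x : ι → Idx → 𝕜}
    (hx : ∀ i, IsNegligible (x i)) : IsNegligible fun ε => ∑ i, x i ε :=
  fun m => IsBigO.fun_sum fun i _ => hx i m

theorem IsNegligible.of_pow {x : Idx → 𝕜} {k : ℕ} (hk : k ≠ 0)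
    (h : IsNegligible fun ε => x ε ^ k) : IsNegligible x := fun m => by
  refine IsBigO.of_pow hk ((h (m * k)).congr_right fun ε => ?_)
  rw [Pi.pow_apply, zpow_mul, zpow_natCast]

theorem isModerate_select {n : ℕ} {x : Fin n → Idx → 𝕜} (hx : ∀ i, IsModerate (x i))
    (f : Idx → Fin n) : IsModerate fun ε => x (f ε) ε := by
  refine (IsModerate.sum fun i => (hx i).norm).of_norm_le fun ε => ?_
  rw [Real.norm_of_nonneg (Finset.sum_nonneg fun i _ => norm_nonneg _)]
  exact Finset.single_le_sum (f := fun i => ‖x i ε‖) (fun i _ => norm_nonneg _)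
    (Finset.mem_univ (f ε))

theorem mk_eq_mk_iff {x y : moderate 𝕜} :
    Ideal.Quotient.mk (negligible 𝕜) x = Ideal.Quotient.mk (negligible 𝕜) y ↔
      IsNegligible fun ε => x.1 ε - y.1 ε :=
  Ideal.Quotient.eq

theorem mk_eq_zero_iff {x : moderate 𝕜} :
    Ideal.Quotient.mk (negligible 𝕜) x = 0 ↔ IsNegligible x.1 :=
  Ideal.Quotient.eq_zero_iff_mem

variable (𝕜) in
/-- The value of a moderate net at an index. -/
def evalAt (ε : Idx) : moderate 𝕜 →+* 𝕜 :=
  (Pi.evalRingHom (fun _ : Idx => 𝕜) ε).comp (moderate 𝕜).subtype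

theorem evalAt_apply (ε : Idx) (x : moderate 𝕜) : evalAt 𝕜 ε x = x.1 ε := rfl

theorem polynomial_ext_evalAt {p q : Polynomial (moderate 𝕜)}
    (h : ∀ ε, p.map (evalAt 𝕜 ε) = q.map (evalAt 𝕜 ε)) : p = q := by
  ext k : 1
  refine Subtype.ext (funext fun ε => ?_)
  simpa [evalAt_apply] using congrArg (fun r => r.coeff k) (h ε)

theorem map_evalAt_prod_X_sub_C {n : ℕ} (a : Fin n → moderate 𝕜) (ε : Idx) :
    (∏ i, (Polynomial.X - Polynomial.C (a i))).map (evalAt 𝕜 ε) =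
      ∏ i, (Polynomial.X - Polynomial.C ((a i).1 ε)) := by
  rw [Polynomial.map_prod]
  simp [evalAt_apply]

/-- If two monic split polynomials over the generalized numbers agree, then their lists of roots
agree up to an index-dependent permutation and negligible nets. -/
theorem exists_perm_of_prod_X_sub_C_eq {n : ℕ} (a b : Fin n → moderate 𝕜)
    (h : ∏ i, (Polynomial.X - Polynomial.C (Ideal.Quotient.mk (negligible 𝕜) (a i))) =
      ∏ i, (Polynomial.X - Polynomial.C (Ideal.Quotient.mk (negligible 𝕜) (b i)))) :
    ∃ σ : Idx → Equiv.Perm (Fin n), ∀ i, IsNegligible fun ε => (a (σ ε i)).1 ε - (b i).1 ε := by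
  induction n with
  | zero => exact ⟨fun _ => 1, fun i => i.elim0⟩
  | succ n ih =>
    have hprod : IsNegligible fun ε => ∏ i, ((b 0).1 ε - (a i).1 ε) := by
      have h0 := congrArg (Polynomial.eval (Ideal.Quotient.mk (negligible 𝕜) (b 0))) h
      rw [Polynomial.eval_prod, Polynomial.eval_prod, eq_comm,
        Finset.prod_eq_zero (Finset.mem_univ (0 : Fin (n + 1))) (by simp), eq_comm] at h0
      simp only [Polynomial.eval_sub, Polynomial.eval_X, Polynomial.eval_C, ← map_sub,
        ← map_prod] at h0
      convert mk_eq_zero_iff.1 h0 using 1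
      ext ε
      exact (map_prod (evalAt 𝕜 ε) (fun i => b 0 - a i) Finset.univ).symm
    -- The root nearest to `b 0`: the `(n+1)`-st power of its distance is at most the negligible
    -- product.
    choose c hc using fun ε : Idx => Finite.exists_min fun i => ‖(b 0).1 ε - (a i).1 ε‖
    have hc0 : IsNegligible fun ε => (a (c ε)).1 ε - (b 0).1 ε := by
      refine IsNegligible.of_pow (Nat.succ_ne_zero n) (hprod.of_norm_le fun ε => ?_)
      rw [norm_pow, norm_sub_rev, norm_prod]
      refine le_trans (le_of_eq ?_)
        (Finset.prod_le_prod (fun i _ => norm_nonneg _) fun i _ => hc ε i)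
      simp
    let a' : Fin (n + 1) → moderate 𝕜 := fun j =>
      ⟨fun ε => (a (Equiv.swap 0 (c ε) j)).1 ε, isModerate_select (fun i => (a i).2) _⟩
    have haa : ∏ j, (Polynomial.X - Polynomial.C (a' j)) =
        ∏ j, (Polynomial.X - Polynomial.C (a j)) := by
      refine polynomial_ext_evalAt fun ε => ?_
      rw [map_evalAt_prod_X_sub_C, map_evalAt_prod_X_sub_C]
      exact Equiv.prod_comp (Equiv.swap 0 (c ε))
        fun j => Polynomial.X - Polynomial.C ((a j).1 ε)
    have ha0 : Ideal.Quotient.mk (negligible 𝕜) (a' 0) = Ideal.Quotient.mk (negligible 𝕜) (b 0) := by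
      rw [mk_eq_mk_iff]
      simpa [a'] using hc0
    have haa' := congrArg (Polynomial.map (Ideal.Quotient.mk (negligible 𝕜))) haa
    simp only [Polynomial.map_prod, Polynomial.map_sub, Polynomial.map_X, Polynomial.map_C] at haa'
    rw [← haa', Fin.prod_univ_succ, Fin.prod_univ_succ, ha0] at h
    -- A monic factor can be cancelled even over a ring with zero divisors.
    obtain ⟨σ, hσ⟩ := ih (fun i => a' i.succ) (fun i => b i.succ)
      ((Polynomial.monic_X_sub_C _).isRegular.left h)
    refine ⟨fun ε => Equiv.swap 0 (c ε) * Equiv.Perm.decomposeFin.symm (0, σ ε), fun i => ?_⟩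
    refine Fin.cases ?_ (fun j => ?_) i
    · simpa using hc0
    · simpa [a'] using hσ j

end Nets

theorem isModerate_ofReal_iff {x : Idx → ℝ} :
    IsModerate (fun ε => (x ε : ℂ)) ↔ IsModerate x :=
  exists_congr (isBigO_ofReal_iff x)

theorem ofReal_mk (x : moderate ℝ) :
    ofReal (Ideal.Quotient.mk (negligible ℝ) x) =
      Ideal.Quotient.mk (negligible ℂ) (moderateOfReal x) := rfl

/-! ### Generalized eigenvalues and their independence of choices. -/

section Eigenvalues

variable {n : ℕ}

theorem IsOrderedEigenvalues.charpoly_eq {M : Matrix (Fin n) (Fin n) ℝ} {θ : Fin n → ℂ}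
    (h : IsOrderedEigenvalues M θ) :
    (M.map Complex.ofReal).charpoly = ∏ i, (Polynomial.X - Polynomial.C (θ i)) := by
  rw [(IsAlgClosed.splits (M.map Complex.ofReal).charpoly).eq_prod_roots_of_monic
    (Matrix.charpoly_monic _), ← h.1, Multiset.map_map]
  rfl

theorem isModerate_eigenvalues {A : Matrix (Fin n) (Fin n) (GenNum ℝ)}
    {M : Idx → Matrix (Fin n) (Fin n) ℝ} {θ : Idx → Fin n → ℂ} (hM : IsRepresentative M A)
    (hθ : ∀ ε, IsOrderedEigenvalues (M ε) (θ ε)) (k : Fin n) : IsModerate fun ε => θ ε k := by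
  have hmod : IsModerate fun ε => ∑ i, ∑ j, ‖M ε i j‖ :=
    IsModerate.sum fun i => IsModerate.sum fun j => IsModerate.norm (hM i j).1
  refine hmod.of_norm_le fun ε => ?_
  have hroot : ((M ε).map Complex.ofReal).charpoly.IsRoot (θ ε k) := by
    refine Polynomial.isRoot_of_mem_roots ?_
    rw [← (hθ ε).1]
    exact Multiset.mem_map_of_mem _ (Finset.mem_univ k)
  refine le_trans ?_ (le_abs_self _)
  simpa using norm_le_sum_of_isRoot_charpoly hroot

/-- Characteristic polynomials commute with ring homomorphisms: the factorizations at each ε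
assemble over the moderate nets and then descend to the quotient. -/
theorem charpoly_eq_prod_of_isRepresentative {A : Matrix (Fin n) (Fin n) (GenNum ℝ)}
    {M : Idx → Matrix (Fin n) (Fin n) ℝ} (hM : IsRepresentative M A) (t : Fin n → moderate ℂ)
    (ht : ∀ ε, ((M ε).map Complex.ofReal).charpoly =
      ∏ i, (Polynomial.X - Polynomial.C ((t i).1 ε))) :
    (A.map ofReal).charpoly =
      ∏ i, (Polynomial.X - Polynomial.C (Ideal.Quotient.mk (negligible ℂ) (t i))) := by
  let N : Matrix (Fin n) (Fin n) (moderate ℂ) := fun i j =>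
    moderateOfReal ⟨fun ε => M ε i j, (hM i j).1⟩
  have hN : A.map ofReal = (Ideal.Quotient.mk (negligible ℂ)).mapMatrix N := by
    ext i j
    rw [Matrix.map_apply, ← (hM i j).2, ofReal_mk]
    rfl
  have hchar : N.charpoly = ∏ i, (Polynomial.X - Polynomial.C (t i)) := by
    refine polynomial_ext_evalAt fun ε => ?_
    rw [map_evalAt_prod_X_sub_C, ← ht ε, ← Matrix.charpoly_map]
    rfl
  rw [hN, RingHom.mapMatrix_apply, Matrix.charpoly_map, hchar, Polynomial.map_prod]
  simp

/-- The ordered eigenvalues of any representative agree, up to negligible nets, with those of a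
representative with real eigenvalues. -/
theorem represents_eigenvalue {A : Matrix (Fin n) (Fin n) (GenNum ℝ)}
    {M S : Idx → Matrix (Fin n) (Fin n) ℝ} {θ : Idx → Fin n → ℂ} {s : Fin n → moderate ℝ}
    (hM : IsRepresentative M A) (hθ : ∀ ε, IsOrderedEigenvalues (M ε) (θ ε))
    (hS : IsRepresentative S A)
    (hs : ∀ ε, IsOrderedEigenvalues (S ε) fun k => ((s k).1 ε : ℂ)) (k : Fin n) :
    Represents (fun ε => θ ε k) (ofReal (Ideal.Quotient.mk (negligible ℝ) (s k))) := by
  let t : Fin n → moderate ℂ := fun k => ⟨fun ε => θ ε k, isModerate_eigenvalues hM hθ k⟩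
  have h1 := charpoly_eq_prod_of_isRepresentative hM t fun ε => (hθ ε).charpoly_eq
  have h2 := charpoly_eq_prod_of_isRepresentative hS (fun i => moderateOfReal (s i))
    fun ε => (hs ε).charpoly_eq
  obtain ⟨σ, hσ⟩ := exists_perm_of_prod_X_sub_C_eq _ _ (h1.symm.trans h2)
  refine ⟨(t k).2, ?_⟩
  rw [ofReal_mk, mk_eq_mk_iff]
  -- The sum of the errors serves as one `δ` valid for all indices at once.
  have hsum := IsNegligible.sum fun i => (hσ i).norm
  have htwo : IsNegligible fun ε =>
      2 * ∑ i, ‖(t (σ ε i)).1 ε - (moderateOfReal (s i)).1 ε‖ :=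
    fun m => (hsum m).const_mul_left 2
  refine htwo.of_norm_le fun ε => ?_
  refine le_trans ?_ (le_abs_self _)
  exact norm_sub_ofReal_le_of_perm (hθ ε).2 (fun i j hij => by simpa using (hs ε).2 hij) (σ ε)
    (fun i => Finset.single_le_sum
      (f := fun i => ‖(t (σ ε i)).1 ε - (moderateOfReal (s i)).1 ε‖)
      (fun i _ => norm_nonneg _) (Finset.mem_univ i)) k

theorem isOrderedEigenvalues_of_diagonalization {S U : Matrix (Fin n) (Fin n) ℝ} {s : Fin n → ℝ}
    (hU : U * U.transpose = 1) (h : U * S * U.transpose = Matrix.diagonal s) (hs : Antitone s) :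
    IsOrderedEigenvalues S fun k => (s k : ℂ) := by
  refine ⟨?_, by simpa using hs⟩
  rw [show S.map Complex.ofReal = S.map Complex.ofRealHom from rfl, Matrix.charpoly_map,
    charpoly_eq_prod_of_diagonalization hU h, Polynomial.map_prod]
  simp only [Polynomial.map_sub, Polynomial.map_X, Polynomial.map_C, Complex.ofRealHom_eq_coe]
  rw [show (∏ i, (Polynomial.X - Polynomial.C (s i : ℂ))) =
    ((Finset.univ.val.map fun i => (s i : ℂ)).map fun z =>
      Polynomial.X - Polynomial.C z).prod by rw [Multiset.map_map]; rfl,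
    Polynomial.roots_multiset_prod_X_sub_C]

theorem exists_symmetric_isRepresentative {A : Matrix (Fin n) (Fin n) (GenNum ℝ)}
    (hA : A.IsSymm) : ∃ S, IsRepresentative S A ∧ ∀ ε, (S ε).IsSymm := by
  choose x hx using fun i j => Ideal.Quotient.mk_surjective (I := negligible ℝ) (A i j)
  refine ⟨fun ε => Matrix.of fun i j => (x (min i j) (max i j)).1 ε, fun i j => ⟨(x (min i j) (max i j)).2, ?_⟩,
    fun ε => ?_⟩
  · refine (hx _ _).trans ?_
    rcases le_total i j with h | h
    · rw [min_eq_left h, max_eq_right h]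
    · rw [min_eq_right h, max_eq_left h, hA.apply]
  · ext i j
    simp only [Matrix.transpose_apply, Matrix.of_apply, min_comm, max_comm]

end Eigenvalues

/-! ### Invertibility of generalized real numbers. -/

section Units

theorem isUnit_mk_of_eventually_le {x : moderate ℝ} {m : ℕ}
    (h : ∀ᶠ ε : Idx in toZero, (ε : ℝ) ^ m ≤ |x.1 ε|) :
    IsUnit (Ideal.Quotient.mk (negligible ℝ) x) := by
  have hinv : IsModerate fun ε => (x.1 ε)⁻¹ := by
    refine ⟨-(m : ℤ), IsBigO.of_bound 1 (h.mono fun ε hε => ?_)⟩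
    have h0 : (0 : ℝ) < ε := ε.2.1
    rw [zpow_neg, zpow_natCast, norm_inv, norm_inv, one_mul, norm_pow,
      Real.norm_of_nonneg h0.le]
    exact inv_anti₀ (pow_pos h0 m) hε
  refine IsUnit.of_mul_eq_one (Ideal.Quotient.mk (negligible ℝ) ⟨_, hinv⟩) ?_
  rw [← map_mul, ← map_one (Ideal.Quotient.mk (negligible ℝ)), mk_eq_mk_iff]
  intro k
  refine IsBigO.of_bound 0 (h.mono fun ε hε => ?_)
  have h0 : x.1 ε ≠ 0 := abs_pos.1 ((pow_pos ε.2.1 m).trans_le hε)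
  have h1 : x.1 ε * (x.1 ε)⁻¹ - 1 = 0 := by rw [mul_inv_cancel₀ h0, sub_self]
  rw [zero_mul]
  exact (norm_eq_zero.2 h1).le

/-- A generalized number that is not a zero divisor is invertible. -/
theorem isUnit_of_forall_mul_eq_zero {a : GenNum ℝ} (ha : ∀ b, b * a = 0 → b = 0) :
    IsUnit a := by
  obtain ⟨x, rfl⟩ := Ideal.Quotient.mk_surjective a
  by_contra hunit
  have hfreq : ∀ m : ℕ, ∃ᶠ ε : Idx in toZero, |x.1 ε| < (ε : ℝ) ^ m := fun m hm =>
    hunit (isUnit_mk_of_eventually_le (m := m) (hm.mono fun ε => le_of_not_gt))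
  have hnear : ∀ r : ℝ, 0 < r → ∀ᶠ ε : Idx in toZero, (ε : ℝ) < r := fun r hr =>
    tendsto_comap.eventually (gt_mem_nhds hr)
  -- A non-unit is below `ε ^ m` at points `e m → 0`; the indicator of these points will be a
  -- nonzero annihilator.
  choose e he1 he2 using fun m : ℕ =>
    ((hfreq m).and_eventually (hnear (1 / (m + 1)) Nat.one_div_pos_of_nat)).exists
  have hlim : Tendsto e atTop toZero := by
    refine tendsto_comap_iff.2 (squeeze_zero (fun m => (e m).2.1.le) (fun m => (he2 m).le)
      tendsto_one_div_add_atTop_nhds_zero_nat)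
  classical
  let y : Idx → ℝ := (Set.range e).indicator 1
  have hy : IsModerate y := (isModerate_const ℝ 1).of_norm_le fun ε => by
    simpa using norm_indicator_le_norm_self (1 : Idx → ℝ) ε (s := Set.range e)
  have hyx : Ideal.Quotient.mk (negligible ℝ) ⟨y, hy⟩ * Ideal.Quotient.mk (negligible ℝ) x = 0 := by
    rw [← map_mul, mk_eq_zero_iff]
    intro m
    refine IsBigO.trans ?_ (isBigO_zpow_of_le (Int.self_le_toNat m))
    -- For such small ε, `ε = e j` forces `j ≥ m`.
    have hev : ∀ᶠ ε : Idx in toZero, ∀ j ∈ Finset.range m.toNat, (ε : ℝ) < e j :=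
      (Finset.eventually_all _).2 fun j _ => hnear _ (e j).2.1
    refine IsBigO.of_bound 1 (hev.mono fun ε hε => ?_)
    have h0 : (0 : ℝ) < ε := ε.2.1
    rw [zpow_natCast, one_mul, norm_pow, Real.norm_of_nonneg h0.le]
    change |y ε * x.1 ε| ≤ _
    by_cases hr : ε ∈ Set.range e
    · obtain ⟨j, rfl⟩ := hr
      have hj : m.toNat ≤ j := by
        by_contra hj
        exact lt_irrefl _ (hε j (Finset.mem_range.2 (not_le.1 hj)))
      have hy1 : y (e j) = 1 := Set.indicator_of_mem (Set.mem_range_self j) _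
      rw [hy1, one_mul]
      exact (he1 j).le.trans (pow_le_pow_of_le_one h0.le (e j).2.2 hj)
    · have hy0 : y ε = 0 := Set.indicator_of_notMem hr _
      rw [hy0, zero_mul, abs_zero]
      exact pow_nonneg h0.le _
  have hneg := mk_eq_zero_iff.1 (ha _ hyx) 1
  have htend : Tendsto (fun m => y (e m)) atTop (𝓝 0) := by
    refine (hneg.comp_tendsto hlim).trans_tendsto ?_
    simpa [Function.comp_def] using tendsto_comap_iff.1 hlim
  have hone : (fun m => y (e m)) = fun _ => 1 :=
    funext fun m => Set.indicator_of_mem (Set.mem_range_self m) _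
  rw [hone] at htend
  exact one_ne_zero (tendsto_nhds_unique tendsto_const_nhds htend)

end Units

/-! ### Non-degeneracy and diagonalization of generalized matrices. -/

section Main

variable {n : ℕ}

theorem isNonDegenerate_iff_vecMul {A : Matrix (Fin n) (Fin n) (GenNum ℝ)} :
    IsNonDegenerate A ↔ ∀ ξ : Fin n → GenNum ℝ, Matrix.vecMul ξ A = 0 → ξ = 0 := by
  refine forall_congr' fun ξ => imp_congr_left ?_
  simp only [Matrix.dotProduct_mulVec]
  exact dotProduct_eq_zero_iff

theorem isNonDegenerate_iff_isUnit {A U : Matrix (Fin n) (Fin n) (GenNum ℝ)}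
    {lam : Fin n → GenNum ℝ} (hU : U * U.transpose = 1)
    (h : U * A * U.transpose = Matrix.diagonal lam) :
    IsNonDegenerate A ↔ ∀ k, IsUnit (lam k) := by
  have hU' : U.transpose * U = 1 := mul_eq_one_comm.1 hU
  rw [isNonDegenerate_iff_vecMul]
  constructor
  · intro hA k
    refine isUnit_of_forall_mul_eq_zero fun b hb => ?_
    -- If `b` annihilates `lam k`, then `b` times row `k` of `U` lies in the left kernel of `A`.
    have h1 : Matrix.vecMul (Pi.single k b) (U * A * U.transpose) = 0 := by
      rw [h]
      ext i
      rw [Matrix.vecMul_diagonal]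
      rcases eq_or_ne i k with rfl | hik
      · rw [Pi.single_eq_same]
        exact hb
      · simp [hik]
    have h2 : Matrix.vecMul (Matrix.vecMul (Pi.single k b) U) A = 0 := by
      have := congrArg (fun v => Matrix.vecMul v U) h1
      simpa only [Matrix.vecMul_vecMul, mul_assoc, hU', mul_one, Matrix.zero_vecMul] using this
    have h3 := congrArg (fun v => Matrix.vecMul v U.transpose) (hA _ h2)
    simp only [Matrix.vecMul_vecMul, hU, Matrix.vecMul_one, Matrix.zero_vecMul] at h3
    simpa using congrFun h3 k
  · intro hlam ξ hξ
    have h1 : Matrix.vecMul (Matrix.vecMul ξ U.transpose) (Matrix.diagonal lam) = 0 := by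
      rw [← h, Matrix.vecMul_vecMul, ← mul_assoc, ← mul_assoc, hU', one_mul,
        ← Matrix.vecMul_vecMul, hξ, Matrix.zero_vecMul]
    have h2 : Matrix.vecMul ξ U.transpose = 0 := by
      ext k
      have := congrFun h1 k
      rw [Matrix.vecMul_diagonal] at this
      exact (hlam k).mul_left_eq_zero.1 this
    have h3 := congrArg (fun v => Matrix.vecMul v U) h2
    simpa only [Matrix.vecMul_vecMul, hU', Matrix.vecMul_one, Matrix.zero_vecMul] using h3

/-- A symmetric generalized matrix has a representative that is diagonalized by a moderate net of
rotations. -/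
theorem exists_net_diagonalization {A : Matrix (Fin n) (Fin n) (GenNum ℝ)} (hA : A.IsSymm) :
    ∃ (S : Idx → Matrix (Fin n) (Fin n) ℝ) (s : Fin n → moderate ℝ)
      (U : Matrix (Fin n) (Fin n) (GenNum ℝ)), IsRepresentative S A ∧
      (∀ ε, IsOrderedEigenvalues (S ε) fun k => ((s k).1 ε : ℂ)) ∧ IsOrthogonal U ∧
      U * A * U.transpose =
        Matrix.diagonal fun k => Ideal.Quotient.mk (negligible ℝ) (s k) := by
  obtain ⟨S, hS, hsymm⟩ := exists_symmetric_isRepresentative hA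
  choose V s hV hdet hdiag hanti using fun ε => exists_rotation_diagonalization (hsymm ε)
  have hord : ∀ ε, IsOrderedEigenvalues (S ε) fun k => (s ε k : ℂ) := fun ε =>
    isOrderedEigenvalues_of_diagonalization (hV ε) (hdiag ε) (hanti ε)
  have hmod : ∀ i j, IsModerate fun ε => V ε i j := fun i j =>
    (isModerate_const ℝ 1).of_norm_le fun ε => by
      rw [norm_one]
      exact entry_norm_bound_of_unitary ((Matrix.mem_unitaryGroup_iff).2 (hV ε)) i j
  let W : Matrix (Fin n) (Fin n) (moderate ℝ) := fun i j => ⟨fun ε => V ε i j, hmod i j⟩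
  let N : Matrix (Fin n) (Fin n) (moderate ℝ) := fun i j => ⟨fun ε => S ε i j, (hS i j).1⟩
  let d : Fin n → moderate ℝ := fun k =>
    ⟨fun ε => s ε k, isModerate_ofReal_iff.1 (isModerate_eigenvalues hS hord k)⟩
  have hext : ∀ B C : Matrix (Fin n) (Fin n) (moderate ℝ),
      (∀ ε, (evalAt ℝ ε).mapMatrix B = (evalAt ℝ ε).mapMatrix C) → B = C := fun B C h => by
    ext i j ε
    exact congrFun (congrFun (h ε) i) j
  have hWt : ∀ ε, (evalAt ℝ ε).mapMatrix W.transpose = (V ε).transpose := fun ε => rfl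
  have hW : W * W.transpose = 1 := hext _ _ fun ε => by
    rw [map_mul, map_one, hWt]
    exact hV ε
  have hWdet : W.det = 1 := Subtype.ext <| funext fun ε => by
    change evalAt ℝ ε W.det = 1
    rw [RingHom.map_det]
    exact hdet ε
  have hWN : W * N * W.transpose = Matrix.diagonal d := hext _ _ fun ε => by
    rw [map_mul, map_mul, hWt, RingHom.mapMatrix_apply _ (Matrix.diagonal d),
      Matrix.diagonal_map (map_zero _)]
    exact hdiag ε
  let q : moderate ℝ →+* GenNum ℝ := Ideal.Quotient.mk (negligible ℝ)
  have hqN : q.mapMatrix N = A := by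
    ext i j
    exact (hS i j).2
  refine ⟨S, d, q.mapMatrix W, hS, hord, ⟨?_, ?_⟩, ?_⟩
  · have := congrArg q.mapMatrix hW
    rwa [map_mul, map_one] at this
  · rw [← RingHom.map_det, hWdet, map_one]
  · have := congrArg q.mapMatrix hWN
    rwa [map_mul, map_mul, hqN, RingHom.mapMatrix_apply _ (Matrix.diagonal d),
      Matrix.diagonal_map (map_zero _)] at this

end Main

end Colombeau

theorem mainTheorem5 (n : ℕ) (A : Matrix (Fin n) (Fin n) (Colombeau.GenNum ℝ)) (hA : A.IsSymm) :
    (∀ (M : Colombeau.Idx → Matrix (Fin n) (Fin n) ℝ) (θ : Colombeau.Idx → Fin n → ℂ),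
      Colombeau.IsRepresentative M A → (∀ ε, Colombeau.IsOrderedEigenvalues (M ε) (θ ε)) →
        ∀ k, Colombeau.IsModerate fun ε => θ ε k) ∧
    ∃ lam : Fin n → Colombeau.GenNum ℝ,
      (∀ Θ : Fin n → Colombeau.GenNum ℂ,
        Colombeau.IsGeneralizedEigenvalues A Θ ↔ Θ = fun k => Colombeau.ofReal (lam k)) ∧
      (∃ U : Matrix (Fin n) (Fin n) (Colombeau.GenNum ℝ),
        Colombeau.IsOrthogonal U ∧ U * A * U.transpose = Matrix.diagonal lam) ∧
      (Colombeau.IsNonDegenerate A ↔ ∀ k, IsUnit (lam k)) := by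
  obtain ⟨S, s, U, hS, hs, hU, hUA⟩ := Colombeau.exists_net_diagonalization hA
  refine ⟨fun M θ hM hθ k => Colombeau.isModerate_eigenvalues hM hθ k,
    fun k => Ideal.Quotient.mk (Colombeau.negligible ℝ) (s k), fun Θ => ⟨?_, ?_⟩,
    ⟨U, hU, hUA⟩, Colombeau.isNonDegenerate_iff_isUnit hU.1 hUA⟩
  · rintro ⟨M, θ, hM, hθ, hΘ⟩
    funext k
    obtain ⟨_, h1⟩ := hΘ k
    obtain ⟨_, h2⟩ := Colombeau.represents_eigenvalue hM hθ hS hs k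
    exact h1.symm.trans h2
  · rintro rfl
    exact ⟨S, fun ε k => ((s k).1 ε : ℂ), hS, hs,
      fun k => Colombeau.represents_eigenvalue hS hs hS hs k⟩
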